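/- Let $G$ be a finite simple graph with vertex set $V(G)=\{x_1,\dots,x_n\}$, let $\mathbb{K}$ be a field, and let $S=\mathbb{K}[x_1,\dots,x_n]$. Let $I(G)=(x_ix_j \mid x_ix_j\in E(G))\subseteq S$ be the edge ideal of $G$. For an integer $s\ge 1$ let $$I(G)^{(s)}=\bigcap_{\mathfrak{p}\in \mathrm{Min}(I(G))}\mathrm{Ker}\bigl(S\to (S/I(G)^s)_{\mathfrak{p}}\bigr)$$ be its $s$-th symbolic power, where $\mathrm{Min}(I(G))$ is the set of minimal primes of $I(G)$. For a vertex $x$, the star with center $x$ is the subgraph of $G$ whose vertex set is the closed neighborhood $N_G[x]$ and whose edges are the edges of $G$ containing $x$. Let $\alpha_2(G)$, the star packing number of $G$, be the maximum size of a set of stars in $G$ whose vertex sets are pairwise disjoint. Suppose that $G$ is chordal, i.e. that $G$ has no induced cycle of length at least four. Then for every integer $s\ge 1$, $$\operatorname{depth} S/I(G)^{(s)}\ \ge\ \alpha_2(G)-s+1,$$ where $\operatorname{depth} S/I(G)^{(s)}$ is the maximum length of an $S/I(G)^{(s)}$-regular sequence of elements of the ideal $(x_1,\dots,x_n)$. 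-/

import Mathlib

noncomputable section

namespace SimpleGraph

variable {V : Type*}

/-- A graph is chordal if it has no induced cycle of length at least four. -/
def IsChordal (G : SimpleGraph V) : Prop :=
  ∀ n : ℕ, 4 ≤ n → ¬ (cycleGraph n).IsIndContained G

/-- The star with centre `x`: its vertices are the closed neighbourhood of `x` in `G`, and its
edges are the edges of `G` that contain `x`. -/
def starAt (G : SimpleGraph V) (x : V) : G.Subgraph where
  verts := insert x (G.neighborSet x)
  Adj a b := G.Adj a b ∧ (a = x ∨ b = x)
  adj_sub h := h.1
  edge_vert := by
    rintro a b ⟨hab, rfl | rfl⟩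
    · exact Set.mem_insert _ _
    · exact Set.mem_insert_of_mem _ hab.symm
  symm := ⟨fun _ _ h => ⟨h.1.symm, h.2.symm⟩⟩

/-- A star packing is a family of stars of `G` with pairwise disjoint vertex sets. -/
def IsStarPacking (G : SimpleGraph V) (P : Set G.Subgraph) : Prop :=
  (∀ H ∈ P, ∃ x : V, H = G.starAt x) ∧ P.PairwiseDisjoint Subgraph.verts

/-- The star packing number: the largest number of stars in a star packing of `G`. -/
def starPackingNumber (G : SimpleGraph V) : ℕ∞ :=
  ⨆ (P : Set G.Subgraph) (_ : G.IsStarPacking P), P.encard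

/-- The edge ideal of `G` in the polynomial ring over `K` whose variables are the vertices. -/
def edgeIdeal (K : Type*) [Field K] (G : SimpleGraph V) : Ideal (MvPolynomial V K) :=
  Ideal.span {f | ∃ u v : V, G.Adj u v ∧ f = MvPolynomial.X u * MvPolynomial.X v}

end SimpleGraph

/-- The `s`-th symbolic power of an ideal `I` of `R`: the intersection, over the minimal primes `p`
of `I`, of the kernels of the canonical maps from `R` to the localization of `R ⧸ I ^ s` at `p`. -/
def Ideal.symbPower {R : Type*} [CommRing R] (I : Ideal R) (s : ℕ) : Ideal R :=
  ⨅ p : I.minimalPrimes,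
    haveI : (p : Ideal R).IsPrime := p.2.1.1
    LinearMap.ker
      ((LocalizedModule.mkLinearMap (p : Ideal R).primeCompl (R ⧸ I ^ s)).comp
        (Submodule.mkQ (I ^ s)))

/-- The depth of a module `M ≠ 0` with respect to an ideal `J`: the supremum of the lengths of the
`M`-regular sequences whose elements lie in `J`. -/
def Ideal.moduleDepth {R : Type*} [CommRing R] (J : Ideal R)
    (M : Type*) [AddCommGroup M] [Module R M] : ℕ∞ :=
  ⨆ (rs : List R) (_ : (∀ r ∈ rs, r ∈ J) ∧ RingTheory.Sequence.IsRegular M rs), (rs.length : ℕ∞)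

/-- The depth of a nonzero graded module over a polynomial ring over a field, that is, its depth
with respect to the ideal generated by the variables. -/
def MvPolynomial.moduleDepth {V : Type*} {K : Type*} [Field K]
    (M : Type*) [AddCommGroup M] [Module (MvPolynomial V K) M] : ℕ∞ :=
  (MvPolynomial.idealOfVars V K).moduleDepth M

end

/-! Ext from `S/𝔪` detects depth, where `𝔪` is generated by the variables, so it suffices to make
these groups vanish in low degrees. The minimal primes of `I(G)` come from minimal vertex covers,
and `I(G)^(s)` is spanned by the monomials of order at least `s` along every cover
(`symbPower_edgeIdeal`).

The induction (`extVanishesBelow_coverIdeal`) needs a larger family: for `W ⊆ U`, the ideal `J =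
(I(G[U])^(s) : ∏ W) + (variables outside U)`. Given a packing `A` in `G[U]` whose closed
neighbourhoods avoid `W`, vanishing holds below `k` as soon as `k + s ≤ |A| + |W| + 1`. Chordality
supplies a nonisolated simplicial vertex `x`; let `N` be its closed neighbourhood in `G[U]`, a
clique. If some `y ∈ N` is outside `A ∪ W`, the sequence `0 → S/(J : y) → S/J → S/(J, y) → 0`
reduces to adding `y` to `W` or deleting it from `U`. Otherwise `N ⊆ W`, and the colon by `∏ N`
lowers `s` by `|N| - 1`: `W` loses `N`, `A` gains `x`, and the inequality persists. Starting with `W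
= ∅` gives the bound. -/

namespace SimpleGraph

variable {V : Type*}

/-! ### Simplicial vertices of chordal graphs -/

/-- On a walk of minimal length, vertices at positions `i < j` are distinct, and they are adjacent
only if `j = i + 1`. -/
theorem Walk.getVert_of_length_eq_dist {H : SimpleGraph V} {a b : V} (p : H.Walk a b)
    (hp : p.length = H.dist a b) {i j : ℕ} (hij : i < j) (hj : j ≤ p.length) :
    p.getVert i ≠ p.getVert j ∧ (H.Adj (p.getVert i) (p.getVert j) → j = i + 1) := by
  refine ⟨fun h => ?_, fun h => ?_⟩
  · have := dist_le ((p.take i).append ((p.drop j).copy h.symm rfl))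
    simp only [Walk.length_append, Walk.length_copy, Walk.take_length, Walk.drop_length] at this
    omega
  · have := dist_le ((p.take i).append (Walk.cons h (p.drop j)))
    simp only [Walk.length_append, Walk.length_cons, Walk.take_length, Walk.drop_length] at this
    omega

theorem cycleGraph_adj_of_lt {n : ℕ} {u v : Fin n} (h : u < v) :
    (cycleGraph n).Adj u v ↔ (v : ℕ) = u + 1 ∨ ((u : ℕ) = 0 ∧ (v : ℕ) + 1 = n) := by
  have hv := v.isLt
  have h' : (u : ℕ) < v := h
  rw [cycleGraph_adj', Fin.coe_sub_iff_le.mpr h.le, Fin.coe_sub_iff_lt.mpr h]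
  omega

/-- In a chordal graph, two nonadjacent neighbours of `v` are not connected through vertices that
are not adjacent to `v`. -/
theorem IsChordal.not_reachable {G : SimpleGraph V} (hG : G.IsChordal) {v a b : V} {T : Set V}
    (hab : a ≠ b) (hnab : ¬ G.Adj a b) (hva : G.Adj v a) (hvb : G.Adj v b)
    (hT : ∀ t ∈ T, t ≠ v ∧ ¬ G.Adj v t) {H : SimpleGraph V}
    (hH : ∀ x y, H.Adj x y ↔ G.Adj x y ∧ (x ∈ T ∨ x = a ∨ x = b) ∧ (y ∈ T ∨ y = a ∨ y = b)) :
    ¬ H.Reachable a b := by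
  intro hr
  obtain ⟨p, hp⟩ := hr.exists_walk_length_eq_dist
  have key := fun i j hij hj => p.getVert_of_length_eq_dist hp (i := i) (j := j) hij hj
  have h0 : p.getVert 0 = a := p.getVert_zero
  have hk : p.getVert p.length = b := p.getVert_length
  have hmem : ∀ i ≤ p.length, p.getVert i ∈ T ∨ p.getVert i = a ∨ p.getVert i = b := by
    intro i hi
    rcases hi.lt_or_eq with hi | rfl
    · exact ((hH _ _).1 (p.adj_getVert_succ hi)).2.1
    · exact Or.inr (Or.inr hk)
  have hadj : ∀ i j, i < j → j ≤ p.length →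
      (G.Adj (p.getVert i) (p.getVert j) ↔ j = i + 1) := by
    intro i j hij hj
    refine ⟨fun h => (key i j hij hj).2 ((hH _ _).2 ⟨h, hmem _ (by omega), hmem _ hj⟩), ?_⟩
    rintro rfl
    exact ((hH _ _).1 (p.adj_getVert_succ hj)).1
  have hlen : 2 ≤ p.length := by
    by_contra hlt
    have : p.length = 0 ∨ p.length = 1 := by omega
    rcases this with h | h
    · exact hab (h0.symm.trans ((congrArg p.getVert h.symm).trans hk))
    · exact hnab (by
        have := (hadj 0 p.length (by omega) le_rfl).2 (by omega)
        rwa [h0, hk] at this)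
  have hv : ∀ i ≤ p.length, p.getVert i ≠ v ∧
      (G.Adj (p.getVert i) v ↔ i = 0 ∨ i = p.length) := by
    intro i hi
    rcases Nat.eq_zero_or_pos i with rfl | hi0
    · rw [h0]; exact ⟨hva.ne', by simp [hva.symm]⟩
    rcases hi.lt_or_eq with hi' | rfl
    · have hne : p.getVert i ≠ a := fun h => (key 0 i hi0 hi).1 (h0.trans h.symm)
      have hne' : p.getVert i ≠ b := fun h => (key i _ hi' le_rfl).1 (h.trans hk.symm)
      have := hT _ (((hmem i hi).resolve_right (by tauto)))
      exact ⟨this.1, iff_of_false (fun h => this.2 h.symm) (by omega)⟩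
    · rw [hk]; exact ⟨hvb.ne', by simp [hvb.symm]⟩
  -- A shortest walk is an induced path; `v`, placed last, closes it to an induced cycle of length
  -- at least four.
  let f : Fin (p.length + 2) → V := fun i => if (i : ℕ) ≤ p.length then p.getVert i else v
  have hf : ∀ i j : Fin (p.length + 2), i < j →
      f i ≠ f j ∧ (G.Adj (f i) (f j) ↔ (cycleGraph (p.length + 2)).Adj i j) := by
    intro i j hij
    have hij' : (i : ℕ) < j := hij
    have hjl := j.isLt
    rw [cycleGraph_adj_of_lt hij]
    have hi : (i : ℕ) ≤ p.length := by omega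
    by_cases hj : (j : ℕ) ≤ p.length
    · simp only [f, hi, hj, if_true]
      refine ⟨(key _ _ hij' hj).1, (hadj _ _ hij' hj).trans ?_⟩
      omega
    · simp only [f, hi, hj, if_true, if_false]
      refine ⟨(hv _ hi).1, (hv _ hi).2.trans ?_⟩
      omega
  refine hG (p.length + 2) (by omega) ⟨⟨⟨f, fun i j h => ?_⟩, fun {i j} => ?_⟩⟩
  · rcases lt_trichotomy i j with hij | hij | hij
    · exact absurd h (hf i j hij).1
    · exact hij
    · exact absurd h.symm (hf j i hij).1
  · change G.Adj (f i) (f j) ↔ _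
    rcases lt_trichotomy i j with hij | rfl | hij
    · exact (hf i j hij).2
    · simp
    · rw [adj_comm, (hf j i hij).2, adj_comm]

/-- A vertex is simplicial in the subgraph induced on `U` if its neighbours in `U` form a clique. -/
def IsSimplicialIn (G : SimpleGraph V) (U : Finset V) (x : V) : Prop :=
  ∀ y ∈ U, ∀ z ∈ U, G.Adj x y → G.Adj x z → y ≠ z → G.Adj y z

/-- **Dirac's theorem**, in the form used for induction: a vertex of a chordal graph that is not
adjacent to all other vertices has a simplicial non-neighbour. -/
theorem IsChordal.exists_isSimplicialIn_not_adj {G : SimpleGraph V} (hG : G.IsChordal)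
    (U : Finset V) : ∀ v ∈ U, (∃ c ∈ U, c ≠ v ∧ ¬ G.Adj v c) →
      ∃ x ∈ U, x ≠ v ∧ ¬ G.Adj v x ∧ G.IsSimplicialIn U x := by
  classical
  induction U using Finset.strongInduction with
  | H U ih =>
  rintro v hvU ⟨c₀, hc₀U, hc₀v, hc₀⟩
  let T : Set V := {t | t ∈ U ∧ t ≠ v ∧ ¬ G.Adj v t}
  -- `C` is the component of `c₀` among the non-neighbours of `v`, and `S` below is its boundary.
  -- `S` is a clique: two nonadjacent members would be joined through `C`.
  let C : Set V := {t | Relation.ReflTransGen (fun x y => G.Adj x y ∧ x ∈ T ∧ y ∈ T) c₀ t}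
  have hc₀T : c₀ ∈ T := ⟨hc₀U, hc₀v, hc₀⟩
  have hCT : ∀ t ∈ C, t ∈ T := by
    intro t ht
    rcases Relation.ReflTransGen.cases_tail ht with rfl | ⟨_, _, h⟩
    · exact hc₀T
    · exact h.2.2
  let S : Set V := {s | s ∈ U ∧ G.Adj v s ∧ ∃ c ∈ C, G.Adj s c}
  have hS : ∀ a ∈ S, ∀ b ∈ S, a ≠ b → G.Adj a b := by
    rintro a ⟨haU, hva, c, hc, hac⟩ b ⟨hbU, hvb, d, hd, hbd⟩ hab
    by_contra hnab
    let H : SimpleGraph V :=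
      { Adj := fun x y => G.Adj x y ∧ (x ∈ T ∨ x = a ∨ x = b) ∧ (y ∈ T ∨ y = a ∨ y = b)
        symm := ⟨fun x y h => ⟨h.1.symm, h.2.2, h.2.1⟩⟩
        loopless := ⟨fun x h => G.loopless.irrefl x h.1⟩ }
    have hreach : ∀ t ∈ C, H.Reachable c₀ t := by
      intro t ht
      induction ht with
      | refl => exact Reachable.refl _
      | tail _ h ih =>
        exact ih.trans (Adj.reachable (G := H) ⟨h.1, Or.inl h.2.1, Or.inl h.2.2⟩)
    have h1 : H.Adj a c := ⟨hac, by simp, Or.inl (hCT _ hc)⟩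
    have h2 : H.Adj b d := ⟨hbd, by simp, Or.inl (hCT _ hd)⟩
    exact hG.not_reachable hab hnab hva hvb (fun t ht => ht.2) (fun _ _ => Iff.rfl)
      ((h1.reachable.trans (hreach c hc).symm).trans ((hreach d hd).trans h2.reachable.symm))
  let U' : Finset V := U.filter fun t => t ∈ C ∨ t ∈ S
  have hU' : ∀ t, t ∈ U' ↔ t ∈ C ∨ t ∈ S := by
    intro t
    simp only [U', Finset.mem_filter, and_iff_right_iff_imp]
    rintro (h | h)
    · exact (hCT _ h).1
    · exact h.1
  have hU'U : U' ⊂ U := by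
    refine (Finset.ssubset_iff_of_subset (Finset.filter_subset _ _)).2 ⟨v, hvU, fun h => ?_⟩
    rcases (hU' v).1 h with h | h
    · exact (hCT _ h).2.1 rfl
    · exact G.loopless.irrefl v h.2.1
  have hclosed : ∀ c ∈ C, ∀ y ∈ U, G.Adj c y → y ∈ U' := by
    intro c hc y hy hcy
    rw [hU']
    by_cases hvy : G.Adj v y
    · exact Or.inr ⟨hy, hvy, c, hc, hcy.symm⟩
    · have hyv : y ≠ v := by
        rintro rfl
        exact (hCT _ hc).2.2 hcy.symm
      exact Or.inl (Relation.ReflTransGen.tail hc ⟨hcy, hCT _ hc, hy, hyv, hvy⟩)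
  have hfin : ∀ x ∈ C, G.IsSimplicialIn U' x →
      ∃ x ∈ U, x ≠ v ∧ ¬ G.Adj v x ∧ G.IsSimplicialIn U x := fun x hx hs =>
    ⟨x, (hCT _ hx).1, (hCT _ hx).2.1, (hCT _ hx).2.2, fun y hy z hz hxy hxz =>
      hs y (hclosed x hx y hy hxy) z (hclosed x hx z hz hxz) hxy hxz⟩
  -- A vertex `w` equal or adjacent to every member of `S` forces the inductive simplicial vertex, a
  -- non-neighbour of `w`, into `C`. If no such `w` has a non-neighbour in `U'`, then first `S` and
  -- then `C` is joined to everything, so `U'` is a clique.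
  by_cases hw : ∃ w ∈ U', (∀ s ∈ S, s = w ∨ G.Adj w s) ∧ ∃ c ∈ U', c ≠ w ∧ ¬ G.Adj w c
  · obtain ⟨w, hwU', hwS, hc⟩ := hw
    obtain ⟨x, hxU', hxw, hwx, hx⟩ := ih U' hU'U w hwU' hc
    refine hfin x (((hU' x).1 hxU').resolve_right fun h => ?_) hx
    rcases hwS x h with h | h
    · exact hxw h
    · exact hwx h
  · push Not at hw
    have huS : ∀ s ∈ S, ∀ c ∈ U', c ≠ s → G.Adj s c := fun s hs =>
      hw s ((hU' s).2 (Or.inr hs)) fun t ht => by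
        by_cases h : t = s
        · exact Or.inl h
        · exact Or.inr (hS s hs t ht (Ne.symm h))
    have huC : ∀ w ∈ C, ∀ c ∈ U', c ≠ w → G.Adj w c := fun w hwC =>
      hw w ((hU' w).2 (Or.inl hwC)) fun s hs => by
        by_cases h : s = w
        · exact Or.inl h
        · exact Or.inr (huS s hs w ((hU' w).2 (Or.inl hwC)) (Ne.symm h)).symm
    refine hfin c₀ Relation.ReflTransGen.refl fun y hy z hz _ _ hyz => ?_
    rcases (hU' y).1 hy with h | h
    · exact huC y h z hz hyz.symm
    · exact huS y h z hz hyz.symm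

/-- An induced subgraph of a chordal graph with at least one edge has a simplicial vertex that is
not isolated. -/
theorem IsChordal.exists_isSimplicialIn {G : SimpleGraph V} (hG : G.IsChordal) {U : Finset V}
    (hU : ∃ u ∈ U, ∃ v ∈ U, G.Adj u v) :
    ∃ x ∈ U, (∃ y ∈ U, G.Adj x y) ∧ G.IsSimplicialIn U x := by
  classical
  -- Isolated vertices are simplicial too, so they are discarded first.
  let U' : Finset V := U.filter fun u => ∃ v ∈ U, G.Adj u v
  have hU' : ∀ u, u ∈ U' ↔ u ∈ U ∧ ∃ v ∈ U, G.Adj u v := fun u => by simp [U']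
  have hfin : ∀ x ∈ U', G.IsSimplicialIn U' x →
      ∃ x ∈ U, (∃ y ∈ U, G.Adj x y) ∧ G.IsSimplicialIn U x := by
    intro x hx hs
    have hxU := (hU' x).1 hx
    have aux : ∀ y ∈ U, G.Adj x y → y ∈ U' := fun y hy hxy => (hU' y).2 ⟨hy, x, hxU.1, hxy.symm⟩
    exact ⟨x, hxU.1, hxU.2, fun y hy z hz hxy hxz =>
      hs y (aux y hy hxy) z (aux z hz hxz) hxy hxz⟩
  obtain ⟨u, hu, v, hv, huv⟩ := hU
  have huU' : u ∈ U' := (hU' u).2 ⟨hu, v, hv, huv⟩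
  by_cases h : ∃ w ∈ U', ∃ c ∈ U', c ≠ w ∧ ¬ G.Adj w c
  · obtain ⟨w, hw, hc⟩ := h
    obtain ⟨x, hx, -, -, hs⟩ := hG.exists_isSimplicialIn_not_adj U' w hw hc
    exact hfin x hx hs
  · push Not at h
    exact hfin u huU' fun y hy z hz _ _ hyz => h y hy z hz hyz.symm

/-- A star packing is given by a set of centres whose closed neighbourhoods are disjoint. -/
theorem IsStarPacking.exists_centers [Finite V] {G : SimpleGraph V} {P : Set G.Subgraph}
    (hP : G.IsStarPacking P) : ∃ A : Finset V, P.encard = A.card ∧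
      ∀ a ∈ A, ∀ b ∈ A, a ≠ b → ∀ v, ¬ ((v = a ∨ G.Adj a v) ∧ (v = b ∨ G.Adj b v)) := by
  classical
  rcases P.eq_empty_or_nonempty with rfl | ⟨H₀, hH₀⟩
  · exact ⟨∅, by simp⟩
  have : Nonempty V := ⟨(hP.1 H₀ hH₀).choose⟩
  choose! c hc using hP.1
  have hinj : Set.InjOn c P := fun H hH H' hH' h => by rw [hc H hH, hc H' hH', h]
  have hfin : (c '' P).Finite := Set.toFinite _
  refine ⟨hfin.toFinset, ?_, ?_⟩
  · rw [← hinj.encard_image, hfin.encard_eq_coe_toFinset_card]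
  · simp only [Set.Finite.mem_toFinset, Set.mem_image]
    rintro _ ⟨H, hH, rfl⟩ _ ⟨H', hH', rfl⟩ hne v ⟨h, h'⟩
    have hd := hP.2 hH hH' fun h => hne (congrArg c h)
    rw [Function.onFun, hc H hH, hc H' hH', Set.disjoint_left] at hd
    exact hd h h'

end SimpleGraph

/-! ### Vanishing of Ext, colon sequences and depth -/

section ExtVanishing

universe u

open CategoryTheory Abelian

/-- `Ext` into `M` from the residue module `R ⧸ I` vanishes in degrees below `k`. -/
def Ideal.ExtVanishesBelow {R : Type u} [CommRing R] (I : Ideal R) (k : ℕ)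
    (M : Type u) [AddCommGroup M] [Module R M] : Prop :=
  ∀ i < k, Subsingleton (Ext (ModuleCat.of R (R ⧸ I)) (ModuleCat.of R M) i)

namespace Ideal

variable {R : Type u} [CommRing R] {J J' J'' : Ideal R} {y : R}

/-- Multiplication by `y`, as a map `R ⧸ (J : y) → R ⧸ J`. -/
def mulColonMap (h : ∀ f, f ∈ J' ↔ y * f ∈ J) : (R ⧸ J') →ₗ[R] R ⧸ J :=
  Submodule.mapQ J' J (LinearMap.mulLeft R y) fun f hf => (h f).1 hf

/-- The sequence `0 → R ⧸ (J : y) → R ⧸ J → R ⧸ (J + (y)) → 0`. -/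
noncomputable abbrev colonShortComplex (h : ∀ f, f ∈ J' ↔ y * f ∈ J)
    (h' : J'' = J ⊔ Ideal.span {y}) : ShortComplex (ModuleCat.{u} R) :=
  ShortComplex.mk (ModuleCat.ofHom (mulColonMap h))
    (ModuleCat.ofHom (Submodule.factor (le_of_le_of_eq le_sup_left h'.symm : J ≤ J''))) (by
      ext
      change (Submodule.Quotient.mk (y * 1) : R ⧸ J'') = 0
      rw [Submodule.Quotient.mk_eq_zero, h', mul_one]
      exact Ideal.mem_sup_right (Ideal.mem_span_singleton_self y))

theorem mulColonMap_injective (h : ∀ f, f ∈ J' ↔ y * f ∈ J) :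
    Function.Injective (mulColonMap h) := by
  rw [injective_iff_map_eq_zero]
  intro x hx
  obtain ⟨f, rfl⟩ := Submodule.Quotient.mk_surjective J' x
  change (Submodule.Quotient.mk (y * f) : R ⧸ J) = 0 at hx
  rw [Submodule.Quotient.mk_eq_zero] at hx ⊢
  exact (h f).2 hx

theorem exact_mulColonMap (h : ∀ f, f ∈ J' ↔ y * f ∈ J) (hJ : J ≤ J'')
    (h' : J'' = J ⊔ Ideal.span {y}) (x : R ⧸ J) (hx : Submodule.factor hJ x = 0) :
    ∃ z, mulColonMap h z = x := by
  obtain ⟨f, rfl⟩ := Submodule.Quotient.mk_surjective J x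
  change (Submodule.Quotient.mk f : R ⧸ J'') = 0 at hx
  rw [Submodule.Quotient.mk_eq_zero, h', Submodule.mem_sup] at hx
  obtain ⟨a, ha, b, hb, rfl⟩ := hx
  obtain ⟨c, rfl⟩ := Ideal.mem_span_singleton'.1 hb
  refine ⟨Submodule.Quotient.mk c, (Submodule.Quotient.eq J).2 ?_⟩
  change y * c - (a + c * y) ∈ J
  rw [show y * c - (a + c * y) = -a by ring]
  exact J.neg_mem ha

theorem colonShortComplex_shortExact (h : ∀ f, f ∈ J' ↔ y * f ∈ J)
    (h' : J'' = J ⊔ Ideal.span {y}) : (colonShortComplex h h').ShortExact where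
  exact := (ShortComplex.moduleCat_exact_iff _).2 fun x hx =>
    exact_mulColonMap h (le_of_le_of_eq le_sup_left h'.symm) h' x hx
  mono_f := (ModuleCat.mono_iff_injective _).2 (mulColonMap_injective h)
  epi_g := (ModuleCat.epi_iff_surjective _).2 
    (Submodule.factor_surjective (le_of_le_of_eq le_sup_left h'.symm))

end Ideal

namespace CategoryTheory.ShortComplex.ShortExact

variable {R : Type u} [CommRing R] {S : ShortComplex (ModuleCat.{u} R)} {N : ModuleCat.{u} R}

theorem subsingleton_ext_X₂ (hS : S.ShortExact) {i : ℕ} (h₁ : Subsingleton (Ext N S.X₁ i))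
    (h₃ : Subsingleton (Ext N S.X₃ i)) : Subsingleton (Ext N S.X₂ i) := by
  refine subsingleton_of_forall_eq 0 fun x => ?_
  obtain ⟨z, rfl⟩ := Ext.covariant_sequence_exact₂ _ hS x (Subsingleton.elim _ _)
  rw [Subsingleton.elim z 0, Ext.zero_comp]

theorem subsingleton_ext_X₁_zero (hS : S.ShortExact)
    (hf : ∀ x : Ext N S.X₁ 0, x.comp (Ext.mk₀ S.f) (add_zero 0) = 0) :
    Subsingleton (Ext N S.X₁ 0) := by
  have := hS.mono_f
  exact ⟨fun x x' => Ext.postcomp_mk₀_injective_of_mono N S.f ((hf x).trans (hf x').symm)⟩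

theorem subsingleton_ext_X₁_succ (hS : S.ShortExact) {i : ℕ}
    (hf : ∀ x : Ext N S.X₁ (i + 1), x.comp (Ext.mk₀ S.f) (add_zero (i + 1)) = 0)
    (h₃ : Subsingleton (Ext N S.X₃ i)) : Subsingleton (Ext N S.X₁ (i + 1)) := by
  refine subsingleton_of_forall_eq 0 fun x => ?_
  obtain ⟨z, rfl⟩ := Ext.covariant_sequence_exact₁ _ hS x (hf x) rfl
  rw [Subsingleton.elim z 0, Ext.zero_comp]

end CategoryTheory.ShortComplex.ShortExact

/-- The actions of `r` on Ext through the two arguments agree, and the one through `N` is zero. -/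
theorem CategoryTheory.Abelian.Ext.comp_mk₀_smul_id_eq_zero {R : Type u} [CommRing R]
    {M N : ModuleCat.{u} R} {r : R} (hr : r ∈ Module.annihilator R N) {n : ℕ} (x : Ext N M n) :
    x.comp (Ext.mk₀ (r • 𝟙 M)) (add_zero n) = 0 := by
  have h : r • 𝟙 N = 0 := by
    simp [← ModuleCat.lsmul_eq_smul_id, Module.mem_annihilator_iff_lsmul_eq_zero.mp hr]
  have hx : r • x = (Ext.mk₀ (r • 𝟙 N)).comp x (zero_add n) := by simp [Ext.mk₀_smul]
  rw [Ext.mk₀_smul, Ext.comp_smul, Ext.comp_mk₀_id, hx, h, Ext.mk₀_zero, Ext.zero_comp]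

namespace Ideal

variable {R : Type u} [CommRing R] {J J' J'' : Ideal R} {y : R}

theorem ExtVanishesBelow.of_colon {I : Ideal R} {k : ℕ} (h : ∀ f, f ∈ J' ↔ y * f ∈ J)
    (h' : J'' = J ⊔ Ideal.span {y}) (h₁ : I.ExtVanishesBelow k (R ⧸ J'))
    (h₃ : I.ExtVanishesBelow k (R ⧸ J'')) : I.ExtVanishesBelow k (R ⧸ J) := fun i hi =>
  (colonShortComplex_shortExact h h').subsingleton_ext_X₂ (h₁ i hi) (h₃ i hi)

/-- Here `y` is regular on `R ⧸ J` but kills `R ⧸ I`, hence acts as zero on Ext. The long exact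
sequence then makes each Ext into `R ⧸ J` a quotient of the Ext into `R ⧸ J''` one degree lower. -/
theorem ExtVanishesBelow.succ_of_mem {I : Ideal R} {k : ℕ} (hy : y ∈ I)
    (h : ∀ f, f ∈ J ↔ y * f ∈ J) (h' : J'' = J ⊔ Ideal.span {y})
    (h₃ : I.ExtVanishesBelow k (R ⧸ J'')) : I.ExtVanishesBelow (k + 1) (R ⧸ J) := by
  have hann : y ∈ Module.annihilator R (ModuleCat.of R (R ⧸ I)) := by
    change y ∈ Module.annihilator R (R ⧸ I)
    rwa [Ideal.annihilator_quotient]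
  have hf : ModuleCat.ofHom (mulColonMap h) = y • 𝟙 (ModuleCat.of R (R ⧸ J)) := by
    ext
    rfl
  have hzero : ∀ (i : ℕ) (x : Ext (ModuleCat.of R (R ⧸ I)) (ModuleCat.of R (R ⧸ J)) i),
      x.comp (Ext.mk₀ (ModuleCat.ofHom (mulColonMap h))) (add_zero i) = 0 := by
    intro i x
    rw [hf]
    exact Ext.comp_mk₀_smul_id_eq_zero hann x
  intro i hi
  cases i with
  | zero => exact (colonShortComplex_shortExact h h').subsingleton_ext_X₁_zero (hzero 0)
  | succ i =>
    exact (colonShortComplex_shortExact h h').subsingleton_ext_X₁_succ (hzero (i + 1))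
      (h₃ i (by omega))

theorem ExtVanishesBelow.of_eq_top {I : Ideal R} (k : ℕ) (hJ : J = ⊤) :
    I.ExtVanishesBelow k (R ⧸ J) := by
  intro i _
  have : Subsingleton (R ⧸ J) := Ideal.Quotient.subsingleton_iff.2 hJ
  have h0 : 𝟙 (ModuleCat.of R (R ⧸ J)) = 0 := by
    ext
    exact Subsingleton.elim (α := R ⧸ J) _ _
  refine subsingleton_of_forall_eq 0 fun x => ?_
  rw [← Ext.comp_mk₀_id x, h0, Ext.mk₀_zero, Ext.comp_zero]

/-- Vanishing of `Ext` bounds the depth from below. -/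
theorem ExtVanishesBelow.le_moduleDepth [IsNoetherianRing R] {I : Ideal R} {k : ℕ} (hI : I ≠ ⊤)
    (hJ : J ≤ I) (h : I.ExtVanishesBelow k (R ⧸ J)) : (k : ℕ∞) ≤ I.moduleDepth (R ⧸ J) := by
  have hlt : I • (⊤ : Submodule R (ModuleCat.of R (R ⧸ J))) < ⊤ := by
    rw [lt_top_iff_ne_top]
    intro htop
    have h1 : (Submodule.Quotient.mk 1 : R ⧸ J) ∈ I • (⊤ : Submodule R (R ⧸ J)) := by
      change _ ∈ I • (⊤ : Submodule R (ModuleCat.of R (R ⧸ J)))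
      rw [htop]; trivial
    have h2 : I • (⊤ : Submodule R (R ⧸ J)) ≤ Submodule.map J.mkQ I := by
      rw [Submodule.smul_le]
      intro r hr n _
      obtain ⟨f, rfl⟩ := Submodule.Quotient.mk_surjective J n
      exact ⟨r * f, I.mul_mem_right f hr, rfl⟩
    obtain ⟨g, hg, hg1⟩ := h2 h1
    have h3 : g - 1 ∈ I := hJ ((Submodule.Quotient.eq J).1 hg1)
    exact hI ((Ideal.eq_top_iff_one I).2 (by simpa using I.sub_mem hg h3))
  have hsupp : Module.support R (ModuleCat.of R (R ⧸ I)) = PrimeSpectrum.zeroLocus I := by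
    rw [Module.support_eq_zeroLocus, Ideal.annihilator_quotient]
  obtain ⟨rs, hlen, hmem, hreg⟩ := ModuleCat.exists_isRegular_of_exists_subsingleton_ext I k
    (ModuleCat.of R (R ⧸ J)) hlt (ModuleCat.of R (R ⧸ I)) hsupp h
  rw [← hlen]
  exact le_iSup₂_of_le (f := fun (rs : List R) (_ : (∀ r ∈ rs, r ∈ I) ∧
    RingTheory.Sequence.IsRegular (R ⧸ J) rs) => (rs.length : ℕ∞)) rs ⟨hmem, hreg⟩ le_rfl

end Ideal

end ExtVanishing

/-! ### Monomial ideals described by exponents -/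

namespace MvPolynomial

variable {V K : Type*} [Field K] {E E' : Set (V →₀ ℕ)}

theorem mem_restrictSupportIdeal {hE : IsUpperSet E} {f : MvPolynomial V K} :
    f ∈ restrictSupportIdeal K E hE ↔ ∀ m ∈ f.support, m ∈ E :=
  Iff.rfl

theorem monomial_mem_restrictSupportIdeal {hE : IsUpperSet E} {m : V →₀ ℕ} (hm : m ∈ E) (c : K) :
    monomial m c ∈ restrictSupportIdeal K E hE := by
  classical
  rw [mem_restrictSupportIdeal]
  intro n hn
  rwa [Finset.mem_singleton.1 (support_monomial_subset hn)]

theorem mem_restrictSupportIdeal_iff_X_mul {hE : IsUpperSet E} {hE' : IsUpperSet E'} {y : V}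
    (h : ∀ m, m ∈ E' ↔ Finsupp.single y 1 + m ∈ E) (f : MvPolynomial V K) :
    f ∈ restrictSupportIdeal K E' hE' ↔ X y * f ∈ restrictSupportIdeal K E hE := by
  simp only [mem_restrictSupportIdeal, support_X_mul, Finset.mem_map, addLeftEmbedding_apply,
    forall_exists_index, and_imp, forall_apply_eq_imp_iff₂, h]

theorem restrictSupportIdeal_eq_sup {hE : IsUpperSet E} {hE' : IsUpperSet E'} {y : V}
    (h : ∀ m, m ∈ E' ↔ m ∈ E ∨ m y ≠ 0) :
    restrictSupportIdeal K E' hE' = restrictSupportIdeal K E hE ⊔ Ideal.span {X y} := by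
  refine le_antisymm (fun f hf => ?_) (sup_le (fun f hf m hm => (h m).2 (Or.inl (hf hm))) ?_)
  · rw [f.as_sum]
    refine Ideal.sum_mem _ fun m hm => ?_
    rcases (h m).1 (hf hm) with hm | hm
    · exact Ideal.mem_sup_left (monomial_mem_restrictSupportIdeal hm _)
    · refine Ideal.mem_sup_right (Ideal.mem_span_singleton.2 ?_)
      exact X_dvd_monomial.2 (Or.inr hm)
  · rw [Ideal.span_le, Set.singleton_subset_iff]
    exact monomial_mem_restrictSupportIdeal ((h _).2 (Or.inr (by simp))) _

end MvPolynomial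

/-! ### Cover ideals and the main induction -/

namespace SimpleGraph

open MvPolynomial

variable {V : Type*}

/-- The closed neighbourhoods in `G[U]` of distinct elements of `A` are disjoint. -/
def IsPackingIn (G : SimpleGraph V) (U A : Finset V) : Prop :=
  ∀ a ∈ A, ∀ b ∈ A, a ≠ b → ∀ v ∈ U, ¬ ((v = a ∨ G.Adj a v) ∧ (v = b ∨ G.Adj b v))

theorem IsPackingIn.mono {G : SimpleGraph V} {U U' A A' : Finset V} (h : G.IsPackingIn U A) (hU : U' ⊆ U)
    (hA : A' ⊆ A) : G.IsPackingIn U' A' :=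
  fun a ha b hb hab v hv => h a (hA ha) b (hA hb) hab v (hU hv)

/-- `C` covers all edges of the subgraph of `G` induced on `U`. -/
def IsCoverOf (G : SimpleGraph V) (U C : Finset V) : Prop :=
  ∀ u ∈ U, ∀ v ∈ U, G.Adj u v → u ∈ C ∨ v ∈ C

variable [DecidableEq V]

/-- The exponents `b` such that `b` involves a vertex outside `U`, or the product of `X ^ b` and
the vertices in `W` has order at least `s` along every vertex cover of `G[U]`. -/
def coverExponents (G : SimpleGraph V) (U W : Finset V) (s : ℕ) : Set (V →₀ ℕ) :=
  {b | (∃ z, z ∉ U ∧ b z ≠ 0) ∨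
    ∀ C, G.IsCoverOf U C → s ≤ ∑ v ∈ C, (b v + if v ∈ W then 1 else 0)}

theorem isUpperSet_coverExponents (G : SimpleGraph V) (U W : Finset V) (s : ℕ) :
    IsUpperSet (G.coverExponents U W s) := by
  rintro b c hbc (⟨z, hz, hb⟩ | h)
  · exact Or.inl ⟨z, hz, by have := hbc z; omega⟩
  · exact Or.inr fun C hC => (h C hC).trans (Finset.sum_le_sum fun v _ =>
      Nat.add_le_add_right (hbc v) _)

/-- The monomial ideal generated by the variables outside `U` and the colon ideal of the `s`-th
symbolic power of the edge ideal of `G[U]` by the product of the vertices in `W`. -/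
noncomputable def coverIdeal (K : Type*) [Field K] (G : SimpleGraph V) (U W : Finset V) (s : ℕ) :
    Ideal (MvPolynomial V K) :=
  restrictSupportIdeal K _ (G.isUpperSet_coverExponents U W s)

variable {K : Type*} [Field K] {G : SimpleGraph V} {U W : Finset V} {s : ℕ} {y : V}

theorem mem_coverIdeal_insert_iff (hyU : y ∈ U) (hyW : y ∉ W) (f : MvPolynomial V K) :
    f ∈ G.coverIdeal K U (insert y W) s ↔ X y * f ∈ G.coverIdeal K U W s := by
  refine mem_restrictSupportIdeal_iff_X_mul (fun m => or_congr ?_ ?_) f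
  · refine exists_congr fun z => and_congr_right fun hz => ?_
    have : y ≠ z := fun h => hz (h ▸ hyU)
    simp [this]
  · refine forall₂_congr fun C _ => ?_
    refine iff_of_eq (congrArg (s ≤ ·) (Finset.sum_congr rfl fun v _ => ?_))
    by_cases hv : v = y
    · subst hv
      simp [hyW, add_comm]
    · simp [hv]

theorem coverIdeal_erase_eq_sup (hyU : y ∈ U) (hyW : y ∉ W) :
    G.coverIdeal K (U.erase y) W s = G.coverIdeal K U W s ⊔ Ideal.span {X y} := by
  refine restrictSupportIdeal_eq_sup fun m => ?_
  by_cases hmy : m y = 0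
  · rw [or_iff_left (not_not.2 hmy)]
    refine or_congr (exists_congr fun z => ?_) ⟨fun h C hC => ?_, fun h C hC => ?_⟩
    · by_cases hz : z = y
      · subst hz; simp [hmy]
      · simp [hz]
    · exact h C fun u hu v hv => hC u (Finset.mem_of_mem_erase hu) v (Finset.mem_of_mem_erase hv)
    -- Inserting `y` turns a cover of the smaller graph into one of `G[U]`; since `m y = 0` and `y ∉
    -- W`, the order is unchanged.
    · have h1 := h (insert y C) fun u hu v hv huv => by
        by_cases huy : u = y
        · exact Or.inl (huy ▸ Finset.mem_insert_self _ _)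
        by_cases hvy : v = y
        · exact Or.inr (hvy ▸ Finset.mem_insert_self _ _)
        exact (hC u (Finset.mem_erase.2 ⟨huy, hu⟩) v (Finset.mem_erase.2 ⟨hvy, hv⟩) huv).imp
          (Finset.mem_insert_of_mem) (Finset.mem_insert_of_mem)
      by_cases hyC : y ∈ C
      · rwa [Finset.insert_eq_of_mem hyC] at h1
      · rwa [Finset.sum_insert hyC, hmy, if_neg hyW, zero_add, zero_add] at h1
  · exact iff_of_true (Or.inl ⟨y, by simp, hmy⟩) (Or.inr hmy)

theorem coverIdeal_zero : G.coverIdeal K U W 0 = ⊤ := by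
  rw [eq_top_iff]
  exact fun f _ m _ => Or.inr fun C _ => Nat.zero_le _

theorem mem_coverExponents_of_isIndep (hU : ∀ u ∈ U, ∀ v ∈ U, ¬ G.Adj u v) (hs : s ≠ 0)
    (m : V →₀ ℕ) : m ∈ G.coverExponents U W s ↔ ∃ z, z ∉ U ∧ m z ≠ 0 := by
  refine or_iff_left fun h => hs ?_
  simpa using h ∅ fun u hu v hv huv => (hU u hu v hv huv).elim

/-- Without edges the empty set is a cover, so only the variables outside `U` generate the ideal.
Each variable in `U` is then regular and raises the bound by one. -/
theorem extVanishesBelow_of_isIndep (hs : s ≠ 0) (U : Finset V) (W : Finset V)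
    (hU : ∀ u ∈ U, ∀ v ∈ U, ¬ G.Adj u v) :
    (idealOfVars V K).ExtVanishesBelow U.card (MvPolynomial V K ⧸ G.coverIdeal K U W s) := by
  induction U using Finset.induction with
  | empty => exact fun i hi => absurd hi (by simp)
  | insert y U hy ih =>
    have hU' : ∀ u ∈ U, ∀ v ∈ U, ¬ G.Adj u v := fun u hu v hv =>
      hU u (Finset.mem_insert_of_mem hu) v (Finset.mem_insert_of_mem hv)
    rw [Finset.card_insert_of_notMem hy]
    refine Ideal.ExtVanishesBelow.succ_of_mem (y := X y)
      (Ideal.subset_span (Set.mem_range_self y)) (fun f => ?_) ?_ (ih hU')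
    · refine mem_restrictSupportIdeal_iff_X_mul (fun m => ?_) f
      simp only [mem_coverExponents_of_isIndep hU hs]
      refine exists_congr fun z => and_congr_right fun hz => ?_
      have : y ≠ z := fun h => hz (h ▸ Finset.mem_insert_self _ _)
      simp [this]
    · refine restrictSupportIdeal_eq_sup fun m => ?_
      simp only [mem_coverExponents_of_isIndep hU hs, mem_coverExponents_of_isIndep hU' hs]
      constructor
      · rintro ⟨z, hz, hm⟩
        by_cases hzy : z = y
        · exact Or.inr (hzy ▸ hm)
        · exact Or.inl ⟨z, by simp [hz, hzy], hm⟩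
      · rintro (⟨z, hz, hm⟩ | hm)
        · exact ⟨z, fun h => hz (Finset.mem_insert_of_mem h), hm⟩
        · exact ⟨y, hy, hm⟩

/-- `N` is a clique, and two of its vertices outside `C` would span an uncovered edge. -/
theorem IsCoverOf.card_le_of_isSimplicialIn {x : V} {N C : Finset V} (hC : G.IsCoverOf U C)
    (hx : G.IsSimplicialIn U x) (hxU : x ∈ U) (hN : ∀ y, y ∈ N ↔ y ∈ U ∧ (y = x ∨ G.Adj x y)) :
    N.card ≤ (N ∩ C).card + 1 := by
  have : (N \ C).card ≤ 1 := by
    rw [Finset.card_le_one]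
    intro a ha b hb
    rw [Finset.mem_sdiff, hN] at ha hb
    by_contra hab
    have hadj : G.Adj a b := by
      rcases ha.1.2 with rfl | h
      · exact hb.1.2.resolve_left (Ne.symm hab)
      · rcases hb.1.2 with rfl | h'
        · exact h.symm
        · exact hx a ha.1.1 b hb.1.1 h h' hab
    rcases hC a ha.1.1 b hb.1.1 hadj with h | h
    · exact ha.2 h
    · exact hb.2 h
  have := Finset.card_sdiff_add_card_inter N C
  omega

/-- Taking the colon by all vertices in the closed neighbourhood of a simplicial vertex lowers the
symbolic exponent. -/
theorem coverIdeal_sdiff_of_isSimplicialIn {x : V} {N : Finset V} (hx : G.IsSimplicialIn U x)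
    (hxU : x ∈ U) (hN : ∀ y, y ∈ N ↔ y ∈ U ∧ (y = x ∨ G.Adj x y)) (hNW : N ⊆ W) :
    G.coverIdeal K U W s = G.coverIdeal K U (W \ N) (s - (N.card - 1)) := by
  have hsum : ∀ (b : V →₀ ℕ) (C : Finset V), ∑ v ∈ C, (b v + if v ∈ W then 1 else 0) =
      ∑ v ∈ C, (b v + if v ∈ W \ N then 1 else 0) + (N ∩ C).card := by
    intro b C
    rw [Finset.inter_comm, ← Finset.filter_mem_eq_inter, Finset.card_filter,
      ← Finset.sum_add_distrib]
    refine Finset.sum_congr rfl fun v _ => ?_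
    by_cases hv : v ∈ N
    · simp [hv, hNW hv]
    · simp [hv]
  have hxN : x ∈ N := (hN x).2 ⟨hxU, Or.inl rfl⟩
  have hE : G.coverExponents U W s = G.coverExponents U (W \ N) (s - (N.card - 1)) := by
    ext b
    refine or_congr Iff.rfl ⟨fun h C hC => ?_, fun h C hC => ?_⟩
    -- A cover containing all of `N` stays a cover without `x`, because the neighbours of `x`
    -- remain. Testing on this smaller cover makes `N` contribute only `|N| - 1`.
    · by_cases hNC : N ⊆ C
      · have hC' : G.IsCoverOf U (C.erase x) := by
          intro u hu v hv huv
          by_cases hux : u = x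
          · subst hux
            exact Or.inr (Finset.mem_erase.2 ⟨huv.ne', hNC ((hN v).2 ⟨hv, Or.inr huv⟩)⟩)
          by_cases hvx : v = x
          · subst hvx
            exact Or.inl (Finset.mem_erase.2 ⟨hux, hNC ((hN u).2 ⟨hu, Or.inr huv.symm⟩)⟩)
          exact (hC u hu v hv huv).imp (fun h => Finset.mem_erase.2 ⟨hux, h⟩)
            (fun h => Finset.mem_erase.2 ⟨hvx, h⟩)
        have h1 := h _ hC'
        rw [hsum, Finset.inter_erase, Finset.inter_eq_left.2 hNC,
          Finset.card_erase_of_mem hxN] at h1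
        have h2 := Finset.sum_le_sum_of_subset (f := fun v => b v + if v ∈ W \ N then 1 else 0)
          (Finset.erase_subset x C)
        omega
      · have h1 := h C hC
        rw [hsum] at h1
        have : (N ∩ C).card < N.card := Finset.card_lt_card
          (Finset.inter_subset_left.ssubset_of_ne fun h => hNC (Finset.inter_eq_left.1 h))
        omega
    · have h1 := h C hC
      rw [hsum]
      have := hC.card_le_of_isSimplicialIn hx hxU hN
      omega
  simp only [coverIdeal, hE]

/-- The measure is lexicographic: deleting `y` shrinks `U`, removing a clique from `W` lowers `s`,
and adding `y` to `W` shrinks `U \ W`. -/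
theorem IsChordal.extVanishesBelow_coverIdeal (hG : G.IsChordal) (U W A : Finset V) (s k : ℕ)
    (hAU : A ⊆ U) (hWU : W ⊆ U) (hA : G.IsPackingIn U A)
    (hWA : ∀ w ∈ W, ∀ a ∈ A, ¬ (w = a ∨ G.Adj a w)) (hk : k + s ≤ A.card + W.card + 1) :
    (idealOfVars V K).ExtVanishesBelow k (MvPolynomial V K ⧸ G.coverIdeal K U W s) := by
  classical
  by_cases hs : s = 0
  · subst hs
    exact Ideal.ExtVanishesBelow.of_eq_top k coverIdeal_zero
  have hdisj : Disjoint A W := Finset.disjoint_right.2 fun w hw hwA => hWA w hw w hwA (Or.inl rfl)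
  by_cases hedge : ∃ u ∈ U, ∃ v ∈ U, G.Adj u v
  swap
  · push Not at hedge
    have := Finset.card_le_card (Finset.union_subset hAU hWU)
    rw [Finset.card_union_of_disjoint hdisj] at this
    exact fun i hi => extVanishesBelow_of_isIndep hs U W hedge i (by omega)
  obtain ⟨x, hxU, ⟨x', hx'U, hxx'⟩, hx⟩ := hG.exists_isSimplicialIn hedge
  set N : Finset V := U.filter fun y => y = x ∨ G.Adj x y with hNdef
  have hN : ∀ y, y ∈ N ↔ y ∈ U ∧ (y = x ∨ G.Adj x y) := fun y => by simp [hNdef]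
  have hxN : x ∈ N := (hN x).2 ⟨hxU, Or.inl rfl⟩
  have hx'N : x' ∈ N := (hN x').2 ⟨hx'U, Or.inr hxx'⟩
  have hclique : ∀ a ∈ N, ∀ b ∈ N, a = b ∨ G.Adj b a := by
    intro a ha b hb
    rw [hN] at ha hb
    rcases hb.2 with rfl | hb'
    · exact ha.2
    rcases ha.2 with rfl | ha'
    · exact Or.inr hb'.symm
    by_cases hab : a = b
    · exact Or.inl hab
    · exact Or.inr (hx b hb.1 a ha.1 hb' ha' (Ne.symm hab))
  have hcard : 1 < N.card := Finset.one_lt_card.2 ⟨x, hxN, x', hx'N, hxx'.ne⟩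
  by_cases hy : ∃ y ∈ N, y ∉ W ∧ y ∉ A
  · obtain ⟨y, hyN, hyW, hyA⟩ := hy
    have hyU : y ∈ U := ((hN y).1 hyN).1
    refine Ideal.ExtVanishesBelow.of_colon (mem_coverIdeal_insert_iff hyU hyW)
      (coverIdeal_erase_eq_sup hyU hyW) ?_ ?_
    -- The closed neighbourhoods of `A` are disjoint, so `y` lies in at most one: `A` loses at most
    -- one element while `W` gains one.
    · have hle : (A.filter fun a => y = a ∨ G.Adj a y).card ≤ 1 := by
        rw [Finset.card_le_one]
        intro a ha b hb
        rw [Finset.mem_filter] at ha hb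
        by_contra hab
        exact hA a ha.1 b hb.1 hab y hyU ⟨ha.2, hb.2⟩
      have hadd := Finset.card_filter_add_card_filter_not (s := A) fun a => y = a ∨ G.Adj a y
      have hlt : (U \ insert y W).card < (U \ W).card := by
        refine Finset.card_lt_card ((Finset.ssubset_iff_of_subset
          (Finset.sdiff_subset_sdiff le_rfl (Finset.subset_insert _ _))).2 ⟨y, ?_, ?_⟩)
        · exact Finset.mem_sdiff.2 ⟨hyU, hyW⟩
        · simp
      refine hG.extVanishesBelow_coverIdeal U (insert y W)
        (A.filter fun a => ¬ (y = a ∨ G.Adj a y)) s k ((Finset.filter_subset _ _).trans hAU)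
        (Finset.insert_subset hyU hWU) (hA.mono le_rfl (Finset.filter_subset _ _)) ?_ ?_
      · intro w hw a ha
        rw [Finset.mem_filter] at ha
        rcases Finset.mem_insert.1 hw with rfl | hw
        · exact ha.2
        · exact hWA w hw a ha.1
      · rw [Finset.card_insert_of_notMem hyW]
        omega
    · have hlt : (U.erase y).card < U.card := Finset.card_erase_lt_of_mem hyU
      exact hG.extVanishesBelow_coverIdeal (U.erase y) W A s k
        (Finset.subset_erase.2 ⟨hAU, hyA⟩) (Finset.subset_erase.2 ⟨hWU, hyW⟩)
        (hA.mono (Finset.erase_subset _ _) le_rfl) hWA hk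
  · push Not at hy
    -- A vertex `y` of `N` outside `W` lies in `A`. Another vertex `z` of the clique is adjacent to
    -- `y`, hence not in `W`, hence also in `A`, against the packing.
    have hNW : N ⊆ W := by
      intro y hyN
      by_contra hyW
      have hyA := hy y hyN hyW
      obtain ⟨z, hzN, hzy⟩ := Finset.exists_mem_ne hcard y
      have hyz := hclique z hzN y hyN
      have hzA := hy z hzN fun hzW => hWA z hzW y hyA hyz
      exact hA z hzA y hyA hzy z (hAU hzA) ⟨Or.inl rfl, hyz⟩
    rw [coverIdeal_sdiff_of_isSimplicialIn hx hxU hN hNW]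
    by_cases hs' : s - (N.card - 1) = 0
    · rw [hs']
      exact Ideal.ExtVanishesBelow.of_eq_top k coverIdeal_zero
    have hlt : s - (N.card - 1) < s := by omega
    have hxA : x ∉ A := fun h => hWA x (hNW hxN) x h (Or.inl rfl)
    have hNA : ∀ a ∈ A, ∀ v ∈ U, ¬ ((v = x ∨ G.Adj x v) ∧ (v = a ∨ G.Adj a v)) :=
      fun a ha v hv h => hWA v (hNW ((hN v).2 ⟨hv, h.1⟩)) a ha h.2
    refine hG.extVanishesBelow_coverIdeal U (W \ N) (insert x A) (s - (N.card - 1)) k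
      (Finset.insert_subset hxU hAU) (Finset.sdiff_subset.trans hWU) ?_ ?_ ?_
    · intro a ha b hb hab v hv h
      rcases Finset.mem_insert.1 ha with rfl | ha'
      · exact hNA b (Finset.mem_of_mem_insert_of_ne hb (Ne.symm hab)) v hv h
      · rcases Finset.mem_insert.1 hb with rfl | hb'
        · exact hNA a ha' v hv h.symm
        · exact hA a ha' b hb' hab v hv h
    · intro w hw a ha h
      rw [Finset.mem_sdiff] at hw
      rcases Finset.mem_insert.1 ha with rfl | ha
      · exact hw.2 ((hN w).2 ⟨hWU hw.1, h⟩)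
      · exact hWA w hw.1 a ha h
    · rw [Finset.card_insert_of_notMem hxA, Finset.card_sdiff_of_subset hNW]
      have := Finset.card_le_card hNW
      omega
termination_by (U.card, s, (U \ W).card)

end SimpleGraph

/-! ### Order along coordinate subspaces -/

namespace MvPolynomial

variable {V K : Type*} [Field K]

/-- The polynomials of order at least `n` along the variables in `C`. -/
noncomputable def orderIdeal (K : Type*) [Field K] (C : Finset V) (n : ℕ) :
    Ideal (MvPolynomial V K) :=
  restrictSupportIdeal K {m | n ≤ ∑ v ∈ C, m v} fun _ _ hbc hb =>
    le_trans (α := ℕ) hb (Finset.sum_le_sum fun v _ => hbc v)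

theorem orderIdeal_one_le {C : Finset V} {I : Ideal (MvPolynomial V K)}
    (h : ∀ v ∈ C, X v ∈ I) : orderIdeal K C 1 ≤ I := by
  intro f hf
  rw [f.as_sum]
  refine Ideal.sum_mem _ fun m hm => ?_
  have h1 : 0 < ∑ v ∈ C, m v := hf hm
  obtain ⟨v, hv, hmv⟩ := Finset.exists_ne_zero_of_sum_ne_zero h1.ne'
  exact I.mem_of_dvd (X_dvd_monomial.2 (Or.inr hmv)) (h v hv)

variable [DecidableEq V]

/-- The order of vanishing of a polynomial along the coordinate subspace cut out by the variables
in `C`. -/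
noncomputable def orderAlong (C : Finset V) (f : MvPolynomial V K) : ℕ∞ :=
  (f : MvPowerSeries V K).weightedOrder fun v => if v ∈ C then 1 else 0

/-- Over a field, lowest-weight parts multiply without cancelling. Primality and the bound on powers
both rest on this additivity. -/
theorem orderAlong_mul (C : Finset V) (f g : MvPolynomial V K) :
    orderAlong C (f * g) = orderAlong C f + orderAlong C g := by
  rw [orderAlong, coe_mul, MvPowerSeries.weightedOrder_mul, orderAlong, orderAlong]

variable [Fintype V]

theorem le_orderAlong_iff {C : Finset V} {f : MvPolynomial V K} {n : ℕ} :
    (n : ℕ∞) ≤ orderAlong C f ↔ ∀ m ∈ f.support, n ≤ ∑ v ∈ C, m v := by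
  have hw : ∀ m : V →₀ ℕ, Finsupp.weight (fun v => if v ∈ C then 1 else 0) m = ∑ v ∈ C, m v := by
    intro m
    rw [Finsupp.weight_apply, Finsupp.sum_fintype _ _ (by simp)]
    simp
  refine ⟨fun h m hm => ?_, fun h => MvPowerSeries.nat_le_weightedOrder _ fun m hm => ?_⟩
  · have := h.trans (MvPowerSeries.weightedOrder_le (d := m) _
      (by rwa [coeff_coe, ← mem_support_iff]))
    rw [hw] at this
    exact_mod_cast this
  · rw [hw] at hm
    rw [coeff_coe]
    by_contra hne
    exact absurd (h m (mem_support_iff.2 hne)) (by omega)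

theorem mem_orderIdeal {C : Finset V} {n : ℕ} {f : MvPolynomial V K} :
    f ∈ orderIdeal K C n ↔ (n : ℕ∞) ≤ orderAlong C f :=
  le_orderAlong_iff.symm

theorem X_mem_orderIdeal_one {C : Finset V} {v : V} : X v ∈ orderIdeal K C 1 ↔ v ∈ C := by
  rw [mem_orderIdeal, le_orderAlong_iff]
  simp [support_X, Finsupp.single_apply, Nat.one_le_iff_ne_zero]

theorem isPrime_orderIdeal_one (C : Finset V) : (orderIdeal K C 1).IsPrime := by
  refine ⟨fun h => ?_, fun {f g} h => ?_⟩
  · have := (Ideal.eq_top_iff_one _).1 h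
    rw [mem_orderIdeal, le_orderAlong_iff] at this
    simpa using this 0 (by simp)
  · rw [mem_orderIdeal, orderAlong_mul] at h
    simp only [mem_orderIdeal, Nat.cast_one, Order.one_le_iff_ne_zero] at h ⊢
    by_contra! hne
    simp [hne.1, hne.2] at h

theorem pow_le_orderIdeal {C : Finset V} {I : Ideal (MvPolynomial V K)}
    (h : I ≤ orderIdeal K C 1) (n : ℕ) : I ^ n ≤ orderIdeal K C n := by
  induction n with
  | zero => exact fun f _ => mem_orderIdeal.2 (by simp)
  | succ n ih =>
    rw [pow_succ, Ideal.mul_le]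
    intro f hf g hg
    rw [mem_orderIdeal, orderAlong_mul]
    push_cast
    exact add_le_add (mem_orderIdeal.1 (ih hf)) (by simpa using mem_orderIdeal.1 (h hg))

end MvPolynomial

theorem Ideal.mem_symbPower_iff {R : Type*} [CommRing R] {I : Ideal R} {s : ℕ} {f : R} :
    f ∈ I.symbPower s ↔ ∀ p ∈ I.minimalPrimes, ∃ c, c ∉ p ∧ c * f ∈ I ^ s := by
  simp only [Ideal.symbPower, Submodule.mem_iInf, Subtype.forall]
  refine forall₂_congr fun p hp => ?_
  have := hp.1.1
  change Submodule.mkQ (I ^ s) f ∈ LinearMap.ker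
    (LocalizedModule.mkLinearMap p.primeCompl (R ⧸ I ^ s)) ↔ _
  rw [LocalizedModule.mem_ker_mkLinearMap_iff]
  refine exists_congr fun c => and_congr Iff.rfl ?_
  rw [← map_smul, Submodule.mkQ_apply, Submodule.Quotient.mk_eq_zero, smul_eq_mul]

/-! ### Symbolic powers of edge ideals through vertex covers -/

namespace SimpleGraph

open MvPolynomial

variable {V K : Type*} [Field K] {G : SimpleGraph V}

theorem X_mul_X_mem_edgeIdeal {u v : V} (h : G.Adj u v) :
    (X u * X v : MvPolynomial V K) ∈ G.edgeIdeal K :=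
  Ideal.subset_span ⟨u, v, h, rfl⟩

variable [Fintype V]

theorem edgeIdeal_le_iff_of_isPrime {p : Ideal (MvPolynomial V K)} [hp : p.IsPrime]
    {C : Finset V} (hC : ∀ v, v ∈ C ↔ X v ∈ p) :
    G.edgeIdeal K ≤ p ↔ G.IsCoverOf Finset.univ C := by
  rw [edgeIdeal, Ideal.span_le]
  constructor
  · intro h u _ v _ huv
    rw [hC, hC]
    exact hp.mem_or_mem (h ⟨u, v, huv, rfl⟩)
  · rintro h _ ⟨u, v, huv, rfl⟩
    rcases h u (Finset.mem_univ u) v (Finset.mem_univ v) huv with hu | hv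
    · exact p.mul_mem_right _ ((hC u).1 hu)
    · exact p.mul_mem_left _ ((hC v).1 hv)

variable [DecidableEq V]

theorem edgeIdeal_le_orderIdeal_iff {C : Finset V} :
    G.edgeIdeal K ≤ orderIdeal K C 1 ↔ G.IsCoverOf Finset.univ C :=
  have := isPrime_orderIdeal_one (K := K) C
  edgeIdeal_le_iff_of_isPrime fun _ => X_mem_orderIdeal_one.symm

/-- The minimal primes of the edge ideal are generated by minimal vertex covers. -/
theorem exists_eq_orderIdeal_of_mem_minimalPrimes {p : Ideal (MvPolynomial V K)}
    (hp : p ∈ (G.edgeIdeal K).minimalPrimes) :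
    ∃ C : Finset V, p = orderIdeal K C 1 ∧ G.IsCoverOf Finset.univ C ∧
      ∀ v ∈ C, ∃ u, u ∉ C ∧ G.Adj u v := by
  classical
  have hprime := hp.1.1
  let C : Finset V := Finset.univ.filter fun v => X v ∈ p
  have hCp : ∀ v, v ∈ C ↔ X v ∈ p := fun v => by simp [C]
  have hC : G.IsCoverOf Finset.univ C := (edgeIdeal_le_iff_of_isPrime hCp).1 hp.1.2
  have hle : orderIdeal K C 1 ≤ p := orderIdeal_one_le fun v hv => (hCp v).1 hv
  have heq : p = orderIdeal K C 1 :=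
    le_antisymm (hp.2 ⟨isPrime_orderIdeal_one C, edgeIdeal_le_orderIdeal_iff.2 hC⟩ hle) hle
  refine ⟨C, heq, hC, fun v hv => ?_⟩
  by_contra! hno
  have hC' : G.IsCoverOf Finset.univ (C.erase v) := by
    intro a _ b _ hab
    by_cases hav : a = v
    · subst hav
      exact Or.inr (Finset.mem_erase.2
        ⟨hab.ne', by_contra fun hb => hno b hb hab.symm⟩)
    by_cases hbv : b = v
    · subst hbv
      exact Or.inl (Finset.mem_erase.2 ⟨hav, by_contra fun ha => hno a ha hab⟩)
    exact (hC a (Finset.mem_univ a) b (Finset.mem_univ b) hab).imp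
      (fun h => Finset.mem_erase.2 ⟨hav, h⟩) (fun h => Finset.mem_erase.2 ⟨hbv, h⟩)
  have hle' : orderIdeal K (C.erase v) 1 ≤ p := orderIdeal_one_le fun w hw =>
    (hCp w).1 (Finset.mem_of_mem_erase hw)
  have := hp.2 ⟨isPrime_orderIdeal_one _, edgeIdeal_le_orderIdeal_iff.2 hC'⟩ hle'
  exact Finset.notMem_erase v C (X_mem_orderIdeal_one.1 (this ((hCp v).1 hv)))

theorem exists_mul_monomial_mem_edgeIdeal_pow {C : Finset V}
    (hC : ∀ v ∈ C, ∃ u, u ∉ C ∧ G.Adj u v) {m : V →₀ ℕ} {s : ℕ} (hm : s ≤ ∑ v ∈ C, m v) (a : K) :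
    ∃ c, c ∉ orderIdeal K C 1 ∧ c * monomial m a ∈ G.edgeIdeal K ^ s := by
  have hprime := isPrime_orderIdeal_one (K := K) C
  choose! u huC hu using hC
  -- Each variable `v ∈ C` is paired with a neighbour `u v` outside `C`, so every factor becomes an
  -- edge generator while the multiplier avoids the prime.
  refine ⟨∏ v ∈ C, X (u v) ^ m v, fun h => ?_, ?_⟩
  · obtain ⟨v, hv, h⟩ := Ideal.IsPrime.prod_mem_iff.1 h
    exact huC v hv (X_mem_orderIdeal_one.1 (hprime.mem_of_pow_mem _ h))
  · have hmem : ∏ v ∈ C, (X (u v) * X v : MvPolynomial V K) ^ m v ∈ G.edgeIdeal K ^ s := by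
      refine Ideal.pow_le_pow_right hm ?_
      rw [← Finset.prod_pow_eq_pow_sum]
      exact Ideal.prod_mem_prod fun v hv =>
        Ideal.pow_mem_pow (X_mul_X_mem_edgeIdeal (hu v hv)) _
    refine Ideal.mem_of_dvd _ ?_ hmem
    simp only [mul_pow, Finset.prod_mul_distrib]
    refine mul_dvd_mul_left _ ?_
    rw [monomial_eq, Finsupp.prod_fintype _ _ (by simp)]
    exact (Finset.prod_dvd_prod_of_subset _ _ _ (Finset.subset_univ C)).mul_left _

theorem symbPower_edgeIdeal (s : ℕ) :
    (G.edgeIdeal K).symbPower s = G.coverIdeal K Finset.univ ∅ s := by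
  ext f
  rw [Ideal.mem_symbPower_iff]
  constructor
  · intro h m hm
    refine Or.inr fun C hC => ?_
    have := isPrime_orderIdeal_one (K := K) C
    -- An arbitrary cover contains a minimal one, along which the denominator `c` has order zero;
    -- enlarging the cover can only increase the order of a monomial.
    obtain ⟨p, hp, hpC⟩ := Ideal.exists_minimalPrimes_le (edgeIdeal_le_orderIdeal_iff (K := K).2 hC)
    obtain ⟨c, hc, hcf⟩ := h p hp
    obtain ⟨C', rfl, hC', -⟩ := exists_eq_orderIdeal_of_mem_minimalPrimes hp
    have hsub : C' ⊆ C := fun v hv =>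
      X_mem_orderIdeal_one.1 (hpC (X_mem_orderIdeal_one.2 hv))
    have hcf' := mem_orderIdeal.1 (pow_le_orderIdeal hp.1.2 s hcf)
    have hc0 : orderAlong C' c = 0 := by
      rw [mem_orderIdeal, Nat.cast_one, Order.one_le_iff_ne_zero, not_not] at hc
      exact hc
    rw [orderAlong_mul, hc0, zero_add, le_orderAlong_iff] at hcf'
    simpa using (hcf' m hm).trans (Finset.sum_le_sum_of_subset hsub)
  · intro hf
    rw [← Ideal.mem_symbPower_iff, f.as_sum]
    refine Ideal.sum_mem _ fun m hm => ?_
    rw [Ideal.mem_symbPower_iff]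
    intro p hp
    obtain ⟨C, rfl, hC, hmin⟩ := exists_eq_orderIdeal_of_mem_minimalPrimes hp
    refine exists_mul_monomial_mem_edgeIdeal_pow hmin ?_ _
    rcases hf hm with ⟨z, hz, -⟩ | h
    · exact absurd (Finset.mem_univ z) hz
    · simpa using h C hC

theorem coverIdeal_univ_le_idealOfVars {s : ℕ} (hs : s ≠ 0) :
    G.coverIdeal K Finset.univ ∅ s ≤ idealOfVars V K := by
  refine le_trans (b := orderIdeal K Finset.univ 1) (fun f hf m hm => ?_)
    (orderIdeal_one_le fun v _ => Ideal.subset_span (Set.mem_range_self v))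
  rcases hf hm with ⟨z, hz, -⟩ | h
  · exact absurd (Finset.mem_univ z) hz
  · have := h Finset.univ fun u _ _ _ _ => Or.inl (Finset.mem_univ u)
    simp only [Finset.notMem_empty, if_false, add_zero] at this
    exact (Nat.one_le_iff_ne_zero.2 hs).trans this

end SimpleGraph

theorem MvPolynomial.idealOfVars_ne_top (V K : Type*) [Fintype V] [DecidableEq V] [Field K] :
    idealOfVars V K ≠ ⊤ := by
  refine fun h => (isPrime_orderIdeal_one (K := K) (Finset.univ : Finset V)).ne_top
    (top_le_iff.1 (h ▸ Ideal.span_le.2 ?_))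
  rintro _ ⟨v, rfl⟩
  exact X_mem_orderIdeal_one.2 (Finset.mem_univ v)

/-- For every chordal graph `G` on a finite vertex set and every `s ≥ 1`, the depth of
`S / I(G)^(s)` is at least `α₂(G) - s + 1`. The inequality is written additively, so that no
truncated subtraction occurs. -/
theorem theorem3p6 {V : Type*} [Finite V] (K : Type*) [Field K] (G : SimpleGraph V)
    (hG : G.IsChordal) (s : ℕ) (hs : 1 ≤ s) :
    G.starPackingNumber + 1 ≤
      MvPolynomial.moduleDepth (V := V) (K := K)
        (MvPolynomial V K ⧸ (G.edgeIdeal K).symbPower s) + (s : ℕ∞) := by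
  classical
  have := Fintype.ofFinite V
  rw [SimpleGraph.symbPower_edgeIdeal]
  obtain ⟨t, rfl⟩ := Nat.exists_eq_add_of_le' hs
  rw [Nat.cast_succ, ← add_assoc]
  refine add_le_add_left (iSup₂_le fun P hP => ?_) 1
  obtain ⟨A, hPA, hA⟩ := hP.exists_centers
  rw [hPA]
  -- With `s = t + 1`, the bound is trivial when `|A| ≤ t`; otherwise the induction is applied with
  -- `k = |A| - t`.
  rcases le_total A.card t with hAt | hAt
  · exact le_add_left (Nat.cast_le.2 hAt)
  have hext := hG.extVanishesBelow_coverIdeal (K := K) Finset.univ ∅ A (t + 1) (A.card - t)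
    (Finset.subset_univ A) (Finset.empty_subset _) (fun a ha b hb hab v _ => hA a ha b hb hab v)
    (by simp) (by rw [Finset.card_empty]; omega)
  calc (A.card : ℕ∞) = ((A.card - t : ℕ) : ℕ∞) + t := by
        rw [← Nat.cast_add, Nat.sub_add_cancel hAt]
    _ ≤ _ := add_le_add_left (hext.le_moduleDepth (MvPolynomial.idealOfVars_ne_top V K)
        (SimpleGraph.coverIdeal_univ_le_idealOfVars (Nat.succ_ne_zero t))) _
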